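/- Let $X$ be a real Banach space with continuous dual $X^*$ and bidual $X^{**}$; identify $X$ with its canonical image in $X^{**}$, and write $\langle\cdot,\cdot\rangle$ for the pairings of $X$, and of $X^{**}$, with $X^*$. A set-valued operator $A\colon X\rightrightarrows X^*$ has graph $\operatorname{gra}A=\{(x,x^*)\in X\times X^* : x^*\in Ax\}$ and range $\operatorname{ran}A=\bigcup_{x\in X}Ax$. It is monotone if $\langle x-y,x^*-y^*\rangle\ge 0$ for all $(x,x^*),(y,y^*)\in\operatorname{gra}A$, and maximally monotone if it is monotone and its graph is not properly contained in the graph of a monotone operator. It is a linear relation if $\operatorname{gra}A$ is a linear subspace of $X\times X^*$. Its adjoint $A^*\colon X^{**}\rightrightarrows X^*$ has the graph $$\operatorname{gra}A^*=\{(x^{**},x^*)\in X^{**}\times X^* : \langle a,x^*\rangle-\langle x^{**},a^*\rangle=0\ \text{ for all }(a,a^*)\in\operatorname{gra}A\},$$ and $A^*$ is monotone if $\langle x^{**}-y^{**},x^*-y^*\rangle\ge0$ for all $(x^{**},x^*),(y^{**},y^*)\in\operatorname{gra}A^*$. **Theorem.** Let $A\colon X\rightrightarrows X^*$ be a maximally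 monotone linear relation. Then the following are equivalent. 1. $A$ is of type (D): for every $(x^{**},x^*)\in X^{**}\times X^*$ with $\inf_{(a,a^*)\in\operatorname{gra}A}\langle a-x^{**},a^*-x^*\rangle\ge0$ there is a bounded net $(a_\alpha,a^*_\alpha)_{\alpha\in\Gamma}$ in $\operatorname{gra}A$ such that $a_\alpha\to x^{**}$ in the weak* topology of $X^{**}$ and $a^*_\alpha\to x^*$ in norm. 2. $A$ is of type (NI): for every $(x^{**},x^*)\in X^{**}\times X^*$, $$\sup_{(a,a^*)\in\operatorname{gra}A}\bigl(\langle a,x^*\rangle+\langle x^{**},a^*\rangle-\langle a,a^*\rangle\bigr)\ge\langle x^{**},x^*\rangle.$$ 3. $A^*$ is monotone. 4. $A$ is of type (FP): for every norm-open convex set $U\subseteq X^*$ with $U\cap\operatorname{ran}A\ne\varnothing$ and every $(x,x^*)\in X\times U$, if $\langle x-y,x^*-y^*\rangle\ge0$ for all $(y,y^*)\in\operatorname{gra}A$ with $y^*\in U$, then $(x,x^*)\in\operatorname{gra}A$. In particular, if $A^*$ is monotone, then $A$ is of type (D), and if $A$ is of type (FP), then $A$ is of type (NI). -/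

import Mathlib

open Filter Topology

universe u

/-!
Set-valued operators `A : X ⇉ X*` are given by their graphs, as relations `SetRel X (StrongDual ℝ X)`,
that is, sets of pairs `(x, x*)`. `StrongDual ℝ X` is the continuous dual with its norm topology;
`A.dom` and `A.cod` are the domain and the range of `A`.
-/

namespace MonotoneOperator

variable {X : Type u} [NormedAddCommGroup X] [NormedSpace ℝ X]

/-- `A : X ⇉ X*` is monotone: `⟨x - y, x* - y*⟩ ≥ 0` for all `(x, x*)`, `(y, y*)` in the graph. -/
def IsMonotone (A : SetRel X (StrongDual ℝ X)) : Prop :=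
  ∀ p ∈ A, ∀ q ∈ A, 0 ≤ (p.2 - q.2) (p.1 - q.1)

/-- Monotonicity of an operator `B : X** ⇉ X*`, for the canonical pairing of `X**` and `X*`. -/
def IsMonotoneBidual (B : SetRel (StrongDual ℝ (StrongDual ℝ X)) (StrongDual ℝ X)) : Prop :=
  ∀ p ∈ B, ∀ q ∈ B, 0 ≤ (p.1 - q.1) (p.2 - q.2)

/-- `A` is monotone and has no proper monotone extension, in the sense of graph inclusion. -/
def IsMaximallyMonotone (A : SetRel X (StrongDual ℝ X)) : Prop :=
  Maximal IsMonotone A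

/-- `A` is a linear relation: its graph is a linear subspace of `X × X*`. -/
def IsLinearRelation (A : SetRel X (StrongDual ℝ X)) : Prop :=
  ∃ S : Submodule ℝ (X × StrongDual ℝ X), (S : Set (X × StrongDual ℝ X)) = A

/-- The point `p = (x, x*)` is monotonically related to the set `S ⊆ X × X*`. -/
def IsMonotonicallyRelated (p : X × StrongDual ℝ X) (S : Set (X × StrongDual ℝ X)) : Prop :=
  ∀ q ∈ S, 0 ≤ (p.2 - q.2) (p.1 - q.1)

/-- The adjoint `A* : X** ⇉ X*`: a pair `(x**, x*)` is in its graph iff `(x*, -x**)`, as a functional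
`(a, a*) ↦ ⟨a, x*⟩ + ⟨a*, -x**⟩` on `X × X*`, vanishes on the graph of `A`. -/
def adjoint (A : SetRel X (StrongDual ℝ X)) :
    SetRel (StrongDual ℝ (StrongDual ℝ X)) (StrongDual ℝ X) :=
  {q | ∀ p ∈ A, q.2 p.1 + (-q.1) p.2 = 0}

/-- Type (D). The infimum is taken in the extended reals; the net is a map from a nonempty directed
set `Γ`; its first component converges weak* in `X**`, its second one in norm. The finite subsets of
`X*` paired with `ℕ`, which suffice as index sets, live in the universe of `X`. -/
def IsTypeD (A : SetRel X (StrongDual ℝ X)) : Prop :=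
  ∀ (x'' : StrongDual ℝ (StrongDual ℝ X)) (x' : StrongDual ℝ X),
    (0 : EReal) ≤ ⨅ p ∈ A,
      (((NormedSpace.inclusionInDoubleDual ℝ X p.1 - x'') (p.2 - x') : ℝ) : EReal) →
    ∃ (Γ : Type u) (_ : Preorder Γ) (_ : IsDirected Γ (· ≤ ·)) (_ : Nonempty Γ)
      (a : Γ → X × StrongDual ℝ X),
      (∀ γ, a γ ∈ A) ∧
      Bornology.IsBounded (Set.range a) ∧
      Tendsto
        (fun γ => StrongDual.toWeakDual (NormedSpace.inclusionInDoubleDual ℝ X (a γ).1))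
        atTop (𝓝 (StrongDual.toWeakDual x'')) ∧
      Tendsto (fun γ => (a γ).2) atTop (𝓝 x')

/-- Negative infimum type (NI). The supremum is taken in the extended reals. -/
def IsTypeNI (A : SetRel X (StrongDual ℝ X)) : Prop :=
  ∀ (x'' : StrongDual ℝ (StrongDual ℝ X)) (x' : StrongDual ℝ X),
    ((x'' x' : ℝ) : EReal) ≤ ⨆ p ∈ A, ((x' p.1 + x'' p.2 - p.2 p.1 : ℝ) : EReal)

/-- Fitzpatrick-Phelps type (FP). Open means norm open in `X*`. -/
def IsTypeFP (A : SetRel X (StrongDual ℝ X)) : Prop :=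
  ∀ U : Set (StrongDual ℝ X), IsOpen U → Convex ℝ U → (U ∩ A.cod).Nonempty →
    ∀ (x : X) (x' : StrongDual ℝ X), x' ∈ U →
      IsMonotonicallyRelated (x, x') (A ∩ Set.univ ×ˢ U) → (x, x') ∈ A

end MonotoneOperator

/-!
For a monotone linear relation the form `q (a, a*) = ⟨a, a*⟩` is convex on the graph `S` (the gap in
the convexity inequality at `p` and `r` is a nonnegative multiple of `q (p - r)`), and this replaces
the Fitzpatrick function of the general theory.

* (NI) gives monotonicity of `A*`: for `(x**, x*)` in the graph of `A*` the supremum in (NI) at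
  `(x**, -x*)` is the supremum of `-q`, which is `0`.
* Monotonicity of `A*` gives (D). Let `(x**, x*)` be monotonically related to `S`. Then `q - L`,
  with `L (a, a*) = ⟨a, x*⟩ + ⟨x**, a*⟩`, is bounded below on `S`, and Tikhonov regularization yields
  points `g ∈ S` at which its derivative is small, even after multiplication by `1 + ‖g‖`
  (`exists_almost_critical_point`). A Hahn-Banach extension of this derivative is a small correction
  that moves `(x**, -x*) - (g₁, -g₂)` into `A*`, to a point where the form `⟨x**, x*⟩` is nearly
  `0`. The Cauchy-Schwarz inequality for that form, positive semidefinite on `A*`, shows that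
  `⟨x**, w*⟩ = ⟨w**, x*⟩` for all `(w**, w*)` in `A*` (`apply_eq_apply_of_mem_adjoint`). By
  Hahn-Banach, this is exactly what is needed to approximate `(x**, x*)` by points of `S` with first
  component of norm at most `‖x**‖ + 1` (`exists_mem_near`).
* (NI) gives (FP): if `(x, x*)` is related to the part of `S` over `U`, separate the epigraph of the
  marginal function `a* ↦ inf_a (q - L)` from `U × (-∞, -⟨x, x*⟩)`. By (NI) at `(x - y**, x*)`,
  the slope `y**` of the separating hyperplane attains its maximum over the open set `U` at `x*`,
  so it vanishes, and `(x, x*)` is related to all of `S`.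
* (FP) gives monotonicity of `A*`: if `(x**, x*)` in `A*` has `⟨x**, x*⟩ < 0`, choose `x` in `X` with
  `⟨x, x*⟩ = ⟨x**, x*⟩`. On a thin neighbourhood `U` of the segment `[0, -x*]` the functionals
  `x` and `x**` nearly agree, so that `(x, -x*)` is strictly related to the part of `S` over `U`;
  by (FP) it belongs to that part, and it is not strictly related to itself.
-/

namespace MonotoneOperator

/-! ### Near-critical points of quadratic functions -/

section Tikhonov

variable {E : Type*} [NormedAddCommGroup E] [NormedSpace ℝ E]

/-- A quadratic function `g ↦ b g g - L g` that is bounded below has points `g` at which its derivative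
is small relative to `1 + ‖g‖`. They are near-minimizers of the function after a small multiple of
`‖g‖ ^ 2` is added; that the quadratic part is bounded makes completeness unnecessary. -/
theorem exists_almost_critical_point (b : E →ₗ[ℝ] E →ₗ[ℝ] ℝ) (L : E →ₗ[ℝ] ℝ)
    (hb : ∀ h, b h h ≤ ‖h‖ ^ 2) {c : ℝ} (hc : ∀ g, c ≤ b g g - L g) {ε : ℝ} (hε : 0 < ε) :
    ∃ (g : E) (s : ℝ), 0 ≤ s ∧ s * (1 + ‖g‖) ≤ ε ∧
      ∀ h, |b g h + b h g - L h| ≤ s * ‖h‖ := by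
  obtain ⟨δ, hδ, hδ1, hδε⟩ : ∃ δ : ℝ, 0 < δ ∧ δ ≤ 1 ∧ 19 * δ ≤ ε :=
    ⟨min 1 (ε / 19), by positivity, min_le_left _ _, by
      linarith [min_le_right (1 : ℝ) (ε / 19)]⟩
  obtain ⟨g₀, hg₀⟩ := exists_lt_of_ciInf_lt (f := fun g => b g g - L g)
    (show _ < (⨅ g, (b g g - L g)) + δ by linarith)
  have hmin : ∀ g, (⨅ g, (b g g - L g)) ≤ b g g - L g := fun g =>
    ciInf_le ⟨c, by rintro _ ⟨g, rfl⟩; exact hc g⟩ g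
  set m := ⨅ g, (b g g - L g)
  -- The weight `η` is so small that the penalty at the near-minimizer `g₀` is at most `δ`. This
  -- forces `η * ‖g‖ ^ 2 ≤ 3 * δ` at near-minimizers `g` of the penalized function.
  obtain ⟨η, hη, hηδ, hη₀⟩ : ∃ η : ℝ, 0 < η ∧ η ≤ δ ∧ η * ‖g₀‖ ^ 2 ≤ δ := by
    have h1 : 0 < 1 + ‖g₀‖ ^ 2 := by positivity
    have h2 : δ / (1 + ‖g₀‖ ^ 2) * (1 + ‖g₀‖ ^ 2) = δ := by field_simp
    have h3 : 0 < δ / (1 + ‖g₀‖ ^ 2) := by positivity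
    exact ⟨_, h3, by nlinarith [sq_nonneg ‖g₀‖], by nlinarith⟩
  obtain ⟨g, hg⟩ := exists_lt_of_ciInf_lt (f := fun g => b g g - L g + η * ‖g‖ ^ 2)
    (show _ < (⨅ g, (b g g - L g + η * ‖g‖ ^ 2)) + η ^ 2 by linarith [pow_pos hη 2])
  have hmin' : ∀ h, (⨅ g, (b g g - L g + η * ‖g‖ ^ 2)) ≤ b h h - L h + η * ‖h‖ ^ 2 := fun h =>
    ciInf_le ⟨c, by rintro _ ⟨g, rfl⟩; nlinarith [hc g, sq_nonneg ‖g‖]⟩ h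
  have hnear : ∀ h, b g g - L g + η * ‖g‖ ^ 2 - η ^ 2 ≤ b h h - L h + η * ‖h‖ ^ 2 := fun h => by
    linarith [hmin' h]
  have hgη : η * ‖g‖ ^ 2 ≤ 3 * δ := by
    have := hnear g₀
    have := hmin g
    nlinarith
  have hg0 := norm_nonneg g
  refine ⟨g, 3 * η + 2 * η * ‖g‖, by positivity, ?_, fun h => ?_⟩
  · nlinarith [mul_nonneg hη.le (sq_nonneg (‖g‖ - 1))]
  rcases eq_or_ne h 0 with rfl | hh
  · simp
  have hh' : 0 < ‖h‖ := norm_pos_iff.2 hh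
  -- Near-minimality is tested along `h` with steps of length `η`, since the error is `η ^ 2`.
  have key : ∀ t : ℝ, |t| * ‖h‖ = η → -(t * (b g h + b h g - L h)) ≤
      η * (3 * η + 2 * η * ‖g‖) := fun t ht => by
    have h1 := hnear (g + t • h)
    have h2 : ‖g + t • h‖ ≤ ‖g‖ + η := by
      simpa [norm_smul, ht] using norm_add_le g (t • h)
    have h3 : ‖g + t • h‖ ^ 2 ≤ (‖g‖ + η) ^ 2 := by gcongr
    have h4 : t ^ 2 * b h h ≤ η ^ 2 := by
      rw [← ht, mul_pow, sq_abs]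
      exact mul_le_mul_of_nonneg_left (hb h) (sq_nonneg t)
    simp only [map_add, map_smul, LinearMap.add_apply, LinearMap.smul_apply, smul_eq_mul] at h1
    nlinarith [mul_le_mul_of_nonneg_left h3 hη.le, mul_pos hη hη]
  have hp := key (η / ‖h‖) (by rw [abs_of_pos (by positivity)]; field_simp)
  have hn := key (-(η / ‖h‖)) (by rw [abs_neg, abs_of_pos (by positivity)]; field_simp)
  have hcancel : ∀ d : ℝ, η / ‖h‖ * d ≤ η * (3 * η + 2 * η * ‖g‖) →
      d ≤ (3 * η + 2 * η * ‖g‖) * ‖h‖ := fun d hd => by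
    rw [div_mul_eq_mul_div, div_le_iff₀ hh', mul_assoc] at hd
    exact le_of_mul_le_mul_left hd hη
  exact abs_le'.2 ⟨hcancel _ (by linarith), hcancel _ (by linarith)⟩

end Tikhonov

/-! ### Linear relations and their adjoints -/

variable {X : Type*} [NormedAddCommGroup X] [NormedSpace ℝ X]

/-- The pairing `((a, a*), (y, y*)) ↦ ⟨y, a*⟩` on `X × X*`, restricted to a subspace. -/
def pairingForm (S : Submodule ℝ (X × StrongDual ℝ X)) : S →ₗ[ℝ] S →ₗ[ℝ] ℝ :=
  LinearMap.mk₂ ℝ (fun p q => p.1.2 q.1.1) (by simp) (by simp) (by simp) (by simp)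

theorem IsMonotone.nonneg {S : Submodule ℝ (X × StrongDual ℝ X)}
    (hS : IsMonotone (S : SetRel X (StrongDual ℝ X))) {p : X × StrongDual ℝ X} (hp : p ∈ S) :
    0 ≤ p.2 p.1 := by
  simpa using hS p hp 0 S.zero_mem

theorem mem_adjoint_iff {A : SetRel X (StrongDual ℝ X)}
    {q : StrongDual ℝ (StrongDual ℝ X) × StrongDual ℝ X} :
    q ∈ adjoint A ↔ ∀ p ∈ A, q.2 p.1 = q.1 p.2 := by
  simp [adjoint, ← sub_eq_add_neg, sub_eq_zero]

theorem isMonotoneBidual_adjoint_iff {A : SetRel X (StrongDual ℝ X)} :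
    IsMonotoneBidual (adjoint A) ↔ ∀ q ∈ adjoint A, 0 ≤ q.1 q.2 := by
  refine ⟨fun h q hq => ?_, fun h p hp q hq => h (p - q) ?_⟩
  · simpa using h q hq 0 (mem_adjoint_iff.2 (by simp))
  · rw [mem_adjoint_iff] at hp hq ⊢
    intro r hr
    simp [hp r hr, hq r hr]

theorem le_of_isTypeNI {A : SetRel X (StrongDual ℝ X)} (hA : IsTypeNI A)
    {x'' : StrongDual ℝ (StrongDual ℝ X)} {x' : StrongDual ℝ X} {M : ℝ}
    (hM : ∀ p ∈ A, x' p.1 + x'' p.2 - p.2 p.1 ≤ M) : x'' x' ≤ M :=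
  EReal.coe_le_coe_iff.1 <| (hA x'' x').trans <|
    iSup₂_le fun p hp => EReal.coe_le_coe_iff.2 (hM p hp)

/-! ### Type (D) implies (NI) implies monotonicity of the adjoint -/

/-- Along a bounded net as in (D), `⟨a - x**, a* - x*⟩` tends to `0`, so that it is not bounded below
by a positive constant. -/
theorem IsTypeD.isTypeNI {A : SetRel X (StrongDual ℝ X)} (hA : IsTypeD A) : IsTypeNI A := by
  intro x'' x'
  by_contra! hlt
  obtain ⟨r, hr, hr'⟩ := EReal.lt_iff_exists_real_btwn.1 hlt
  have hsup : ∀ p ∈ A, x' p.1 + x'' p.2 - p.2 p.1 ≤ r := fun p hp =>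
    EReal.coe_le_coe_iff.1 ((le_iSup₂ (f := fun (p : X × StrongDual ℝ X) (_ : p ∈ A) =>
      ((x' p.1 + x'' p.2 - p.2 p.1 : ℝ) : EReal)) p hp).trans hr.le)
  have hr'' : r < x'' x' := EReal.coe_lt_coe_iff.1 hr'
  have hpos : ∀ p ∈ A, x'' x' - r ≤
      (NormedSpace.inclusionInDoubleDual ℝ X p.1 - x'') (p.2 - x') := fun p hp => by
    have := hsup p hp
    simp only [map_sub, sub_apply, NormedSpace.dual_def]
    linarith
  obtain ⟨Γ, _, _, _, a, haA, hbdd, -, hnorm⟩ := hA x'' x' (le_iInf₂ fun p hp =>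
    EReal.coe_nonneg.2 (by linarith [hpos p hp]))
  obtain ⟨C, hC⟩ := hbdd.exists_norm_le
  have hlim : Tendsto (fun γ => (C + ‖x''‖) * ‖(a γ).2 - x'‖) atTop (𝓝 0) := by
    simpa using (tendsto_iff_norm_sub_tendsto_zero.1 hnorm).const_mul (C + ‖x''‖)
  refine absurd (ge_of_tendsto' hlim fun γ => (hpos _ (haA γ)).trans ?_) (by linarith)
  refine (Real.le_norm_self _).trans ((ContinuousLinearMap.le_opNorm _ _).trans ?_)
  gcongr
  refine (norm_sub_le _ _).trans (add_le_add_left ?_ _)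
  exact (NormedSpace.double_dual_bound ℝ X _).trans ((norm_fst_le _).trans (hC _ ⟨γ, rfl⟩))

theorem IsTypeNI.isMonotoneBidual_adjoint {S : Submodule ℝ (X × StrongDual ℝ X)}
    (hS : IsMonotone (S : SetRel X (StrongDual ℝ X)))
    (hNI : IsTypeNI (S : SetRel X (StrongDual ℝ X))) :
    IsMonotoneBidual (adjoint (S : SetRel X (StrongDual ℝ X))) := by
  refine isMonotoneBidual_adjoint_iff.2 fun q hq => ?_
  have := le_of_isTypeNI hNI (x'' := q.1) (x' := -q.2) (M := 0) fun p hp => by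
    have h1 := mem_adjoint_iff.1 hq p hp
    have h2 := hS.nonneg hp
    simp only [neg_apply]
    linarith
  simpa using this

/-! ### Monotonicity of the adjoint implies type (D) -/

/-- A point that is monotonically related to `S` can be moved into the adjoint, after a change of sign,
by subtracting a point `g` of `S` and adding a correction that is small even relative to `‖g‖`. The
correction is an extension of the derivative of `⟨a, a*⟩ - ⟨a, x*⟩ - ⟨x**, a*⟩` at `g`. -/
theorem exists_sub_add_mem_adjoint {S : Submodule ℝ (X × StrongDual ℝ X)}
    {x'' : StrongDual ℝ (StrongDual ℝ X)} {x' : StrongDual ℝ X}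
    (hx : ∀ p ∈ S, 0 ≤ (NormedSpace.inclusionInDoubleDual ℝ X p.1 - x'') (p.2 - x'))
    {ε : ℝ} (hε : 0 < ε) :
    ∃ g ∈ S, ∃ (e'' : StrongDual ℝ (StrongDual ℝ X)) (e' : StrongDual ℝ X) (s : ℝ),
      0 ≤ s ∧ s * (1 + ‖g‖) ≤ ε ∧ ‖e''‖ ≤ s ∧ ‖e'‖ ≤ s ∧
        (x'' - NormedSpace.inclusionInDoubleDual ℝ X g.1 + e'', -(x' - g.2 + e')) ∈
          adjoint (S : SetRel X (StrongDual ℝ X)) := by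
  have hx0 : ∀ p ∈ S, 0 ≤ p.2 p.1 - x' p.1 - x'' p.2 + x'' x' := fun p hp => by
    have := hx p hp
    simp only [map_sub, sub_apply, NormedSpace.dual_def] at this
    linarith
  let L : S →ₗ[ℝ] ℝ := (x'.coprod x'').toLinearMap ∘ₗ S.subtype
  have hL : ∀ p : S, L p = x' p.1.1 + x'' p.1.2 := fun p => by simp [L]
  obtain ⟨g, s, hs, hsg, hD⟩ := exists_almost_critical_point (E := S) (pairingForm S) L
    (fun h => by
      have h1 := (le_abs_self _).trans (h.1.2.le_opNorm h.1.1)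
      have h2 := norm_fst_le h.1
      have h3 := norm_snd_le h.1
      change h.1.2 h.1.1 ≤ ‖h.1‖ ^ 2
      nlinarith [norm_nonneg h.1.1, norm_nonneg h.1.2])
    (c := -x'' x') (fun g => by
      have := hx0 g.1 g.2
      rw [hL]
      change _ ≤ g.1.2 g.1.1 - _
      linarith) hε
  -- The derivative of `q - L` at `g`, extended to a functional `(e', e'')` of norm at most `s`.
  obtain ⟨e, he, hen⟩ := exists_extension_norm_eq S
    (LinearMap.mkContinuous (pairingForm S g + (pairingForm S).flip g - L) s hD)
  have hes : ‖e‖ ≤ s := hen.trans_le (LinearMap.mkContinuous_norm_le _ hs _)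
  obtain ⟨⟨a, a'⟩, hgS⟩ := g
  set e' : StrongDual ℝ X := e.comp (ContinuousLinearMap.inl ℝ X (StrongDual ℝ X))
  set e'' : StrongDual ℝ (StrongDual ℝ X) :=
    e.comp (ContinuousLinearMap.inr ℝ X (StrongDual ℝ X))
  have he' : ‖e'‖ ≤ s := ContinuousLinearMap.opNorm_le_bound _ hs fun y => by
    refine (e.le_opNorm _).trans ?_
    gcongr
    simp
  have he'' : ‖e''‖ ≤ s := ContinuousLinearMap.opNorm_le_bound _ hs fun y => by
    refine (e.le_opNorm _).trans ?_
    gcongr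
    simp
  have hsplit : ∀ p ∈ S, e' p.1 + e'' p.2 = a' p.1 + p.2 a - (x' p.1 + x'' p.2) := fun p hp => by
    have h1 := he ⟨p, hp⟩
    have h2 : e p = e' p.1 + e'' p.2 := by
      simp [e', e'', ← map_add]
    rw [← h2, h1, ← hL ⟨p, hp⟩]
    rfl
  refine ⟨(a, a'), hgS, e'', e', s, hs, hsg, he'', he', mem_adjoint_iff.2 fun p hp => ?_⟩
  have h2 := hsplit p hp
  have h3 : NormedSpace.inclusionInDoubleDual ℝ X a p.2 = p.2 a := NormedSpace.dual_def ..
  simp only [add_apply, sub_apply, neg_apply, h3]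
  linear_combination -h2

/-- If `A*` is monotone, then every point of `X** × X*` that is monotonically related to the graph of
`A` satisfies, in terms of `A*`, the equations that define the closure of this graph for the weak*
topology of `X**` and the norm of `X*`. -/
theorem apply_eq_apply_of_mem_adjoint {S : Submodule ℝ (X × StrongDual ℝ X)}
    (hS' : IsMonotoneBidual (adjoint (S : SetRel X (StrongDual ℝ X))))
    {x'' : StrongDual ℝ (StrongDual ℝ X)} {x' : StrongDual ℝ X}
    (hx : ∀ p ∈ S, 0 ≤ (NormedSpace.inclusionInDoubleDual ℝ X p.1 - x'') (p.2 - x'))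
    {w : StrongDual ℝ (StrongDual ℝ X) × StrongDual ℝ X}
    (hw : w ∈ adjoint (S : SetRel X (StrongDual ℝ X))) : x'' w.2 = w.1 x' := by
  rw [isMonotoneBidual_adjoint_iff] at hS'
  let C := 8 * (w.1 w.2 * (‖x''‖ + ‖x'‖ + 3)) + 2 * (‖w.1‖ + ‖w.2‖) ^ 2
  suffices h : ∀ ε : ℝ, 0 < ε → ε ≤ 1 → (x'' w.2 - w.1 x') ^ 2 ≤ C * ε by
    have hlim : Tendsto (fun ε : ℝ => C * ε) (𝓝[>] 0) (𝓝 0) := by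
      have : Tendsto (fun ε : ℝ => C * ε) (𝓝 0) (𝓝 (C * 0)) := tendsto_id.const_mul C
      rw [mul_zero] at this
      exact this.mono_left nhdsWithin_le_nhds
    have h0 := ge_of_tendsto hlim (b := (x'' w.2 - w.1 x') ^ 2) (by
      filter_upwards [Ioc_mem_nhdsGT (zero_lt_one' ℝ)] with ε hε using h ε hε.1 hε.2)
    exact sub_eq_zero.1 (pow_eq_zero_iff two_ne_zero |>.1 (le_antisymm h0 (sq_nonneg _)))
  intro ε hε hε1
  obtain ⟨⟨a, a'⟩, hgS, e'', e', s, hs, hsg, he'', he', hmem⟩ := exists_sub_add_mem_adjoint hx hε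
  set ι := NormedSpace.inclusionInDoubleDual ℝ X
  set u := x'' - ι a + e'' with hu
  set v := x' - a' + e' with hv
  have huv : ∀ t : ℝ, w + t • (u, -v) ∈ adjoint (S : SetRel X (StrongDual ℝ X)) := fun t => by
    rw [mem_adjoint_iff] at hw ⊢
    intro p hp
    have h1 := hw p hp
    have h2 := mem_adjoint_iff.1 hmem p hp
    simp only [Prod.smul_mk, Prod.fst_add, Prod.snd_add, add_apply, smul_apply, smul_eq_mul]
    linear_combination h1 + t * h2
  -- Cauchy-Schwarz for the form `(w**, w*) ↦ ⟨w**, w*⟩` on `A*`, at `w` and `(u, -v)`.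
  have hCS := discrim_le_zero (a := -u v) (b := u w.2 - w.1 v) (c := w.1 w.2) fun t => by
    have := hS' _ (huv t)
    simp only [Prod.smul_mk, Prod.fst_add, Prod.snd_add, add_apply, smul_apply, map_add, map_smul,
      map_neg, smul_eq_mul] at this
    linarith
  have hw0 := hS' w hw
  have ha := hx (a, a') hgS
  have hna : ‖ι a‖ ≤ ‖(a, a')‖ :=
    (NormedSpace.double_dual_bound ℝ X a).trans (norm_fst_le (a, a'))
  have hna' : ‖a'‖ ≤ ‖(a, a')‖ := norm_snd_le (a, a')
  set G := ‖(a, a')‖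
  have hG : 0 ≤ G := norm_nonneg _
  have hsε : s ≤ ε := (le_mul_of_one_le_right hs (le_add_of_nonneg_right hG)).trans hsg
  have b1 : |(x'' - ι a) e'| ≤ (‖x''‖ + G) * s := by
    refine ((x'' - ι a).le_opNorm e').trans ?_
    gcongr
    exact (norm_sub_le _ _).trans (by gcongr)
  have b2 : |e'' (x' - a')| ≤ s * (‖x'‖ + G) := by
    refine (e''.le_opNorm _).trans ?_
    gcongr
    exact (norm_sub_le _ _).trans (by gcongr)
  have b3 : |e'' e'| ≤ s * s := (e''.le_opNorm _).trans (by gcongr)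
  have buv : -u v ≤ (‖x''‖ + ‖x'‖ + 3) * ε := by
    have h1 : u v = (ι a - x'') (a' - x') + (x'' - ι a) e' + e'' (x' - a') + e'' e' := by
      simp only [hu, hv, map_add, map_sub, add_apply, sub_apply]
      ring
    have h2 := neg_abs_le ((x'' - ι a) e')
    have h3 := neg_abs_le (e'' (x' - a'))
    have h4 := neg_abs_le (e'' e')
    have h5 : (‖x''‖ + ‖x'‖) * s ≤ (‖x''‖ + ‖x'‖) * ε := by gcongr
    have h6 : s * s ≤ ε := (mul_le_of_le_one_left hs (hsε.trans hε1)).trans hsε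
    have h7 : 0 ≤ (ι a - x'') (a' - x') := ha
    linarith
  have b4 : |e'' w.2 - w.1 e'| ≤ (‖w.1‖ + ‖w.2‖) * ε := by
    have h1 : |e'' w.2| ≤ ε * ‖w.2‖ := (e''.le_opNorm _).trans (by gcongr; linarith)
    have h2 : |w.1 e'| ≤ ‖w.1‖ * ε := (w.1.le_opNorm _).trans (by gcongr; linarith)
    linarith [abs_sub (e'' w.2) (w.1 e')]
  have b5 : u w.2 - w.1 v = (x'' w.2 - w.1 x') + (e'' w.2 - w.1 e') := by
    have h1 := mem_adjoint_iff.1 hw (a, a') hgS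
    have h3 : ι a w.2 = w.2 a := NormedSpace.dual_def ..
    simp only [hu, hv, map_add, map_sub, add_apply, sub_apply, h3]
    linear_combination -h1
  have b6 : (e'' w.2 - w.1 e') ^ 2 ≤ (‖w.1‖ + ‖w.2‖) ^ 2 * ε := by
    have h1 := pow_le_pow_left₀ (abs_nonneg _) b4 2
    rw [sq_abs, mul_pow] at h1
    exact h1.trans (mul_le_mul_of_nonneg_left (pow_le_of_le_one hε.le hε1 two_ne_zero)
      (sq_nonneg _))
  have b7 : (u w.2 - w.1 v) ^ 2 ≤ 4 * (w.1 w.2 * ((‖x''‖ + ‖x'‖ + 3) * ε)) := by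
    have := mul_le_mul_of_nonneg_left buv hw0
    simp only [discrim] at hCS
    linarith
  rw [b5] at b7
  have b8 : ∀ α β : ℝ, α ^ 2 ≤ 2 * (α + β) ^ 2 + 2 * β ^ 2 := fun α β => by
    linarith [sq_nonneg (α + 2 * β)]
  calc (x'' w.2 - w.1 x') ^ 2
      ≤ 2 * (x'' w.2 - w.1 x' + (e'' w.2 - w.1 e')) ^ 2 + 2 * (e'' w.2 - w.1 e') ^ 2 := b8 _ _
    _ ≤ 2 * (4 * (w.1 w.2 * ((‖x''‖ + ‖x'‖ + 3) * ε))) + 2 * ((‖w.1‖ + ‖w.2‖) ^ 2 * ε) := by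
        gcongr
    _ = C * ε := by
        simp only [C]
        ring

/-- The Hahn-Banach theorem for the seminorm `p ↦ N * ‖p.1‖` on `E × F`, whose continuous functionals
only depend on the first component. -/
theorem exists_extension_of_le_norm_fst {E F : Type*} [NormedAddCommGroup E] [NormedSpace ℝ E]
    [AddCommGroup F] [Module ℝ F] (S : Submodule ℝ (E × F)) (l : E × F →ₗ[ℝ] ℝ) {N : ℝ}
    (hN : 0 ≤ N) (hl : ∀ p ∈ S, l p ≤ N * ‖p.1‖) :
    ∃ y' : StrongDual ℝ E, ‖y'‖ ≤ N ∧ ∀ p ∈ S, l p = y' p.1 := by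
  obtain ⟨g, hg, hgN⟩ := exists_extension_of_le_sublinear ⟨S, l ∘ₗ S.subtype⟩
    (fun p => N * ‖p.1‖) (fun c hc p => by simp [norm_smul, abs_of_pos hc]; ring)
    (fun p q => by
      rw [← mul_add]
      exact mul_le_mul_of_nonneg_left (norm_add_le _ _) hN)
    (fun p => hl p.1 p.2)
  have h0 : ∀ y : F, g (0, y) = 0 := fun y => by
    have h1 := hgN (0, y)
    have h2 := hgN (-(0, y))
    rw [map_neg] at h2
    simp only [Prod.fst_neg, neg_zero, norm_zero, mul_zero] at h1 h2
    linarith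
  refine ⟨(g ∘ₗ LinearMap.inl ℝ E F).mkContinuous N fun y => abs_le'.2 ⟨hgN (y, 0), ?_⟩,
    LinearMap.mkContinuous_norm_le _ hN _, fun p hp => ?_⟩
  · have := hgN (-(y, 0))
    rw [map_neg] at this
    simpa using this
  · have h1 : g p = g (p.1, 0) + g (0, p.2) := by simp [← map_add]
    have h2 : g p = l p := hg ⟨p, hp⟩
    rw [← h2, h1, h0, add_zero]
    rfl

/-- The bound `‖x''‖ + 1` depends neither on `F` nor on `ε`. Were it not attainable, a separating
functional `(z'', z')` on `X* × X` would agree on `S` with `(0, y')` for some `y'` of small norm, so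
that `(-z'', z' - y')` lies in `A*`, against `hx`. -/
theorem exists_mem_near {S : Submodule ℝ (X × StrongDual ℝ X)}
    {x'' : StrongDual ℝ (StrongDual ℝ X)} {x' : StrongDual ℝ X}
    (hx : ∀ w ∈ adjoint (S : SetRel X (StrongDual ℝ X)), x'' w.2 = w.1 x')
    (F : Finset (StrongDual ℝ X)) {ε : ℝ} (hε : 0 < ε) :
    ∃ p ∈ S, ‖p.1‖ ≤ ‖x''‖ + 1 ∧ ‖p.2 - x'‖ < ε ∧ ∀ f ∈ F, |f p.1 - x'' f| < ε := by
  classical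
  set M := ‖x''‖ + 1 with hM
  have hM0 : 0 < M := by positivity
  let T : X × StrongDual ℝ X →ₗ[ℝ] StrongDual ℝ X × (F → ℝ) :=
    LinearMap.prod (LinearMap.snd ℝ _ _)
      (LinearMap.pi fun f => f.1.toLinearMap ∘ₗ LinearMap.fst ℝ _ _)
  let z : StrongDual ℝ X × (F → ℝ) := (x', fun f => x'' f)
  let K : Set (StrongDual ℝ X × (F → ℝ)) := T '' {p | p ∈ S ∧ ‖p.1‖ ≤ M}
  suffices hz : z ∈ closure K by
    obtain ⟨_, ⟨p, ⟨hpS, hpM⟩, rfl⟩, hp⟩ := Metric.mem_closure_iff.1 hz ε hε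
    rw [dist_comm, dist_eq_norm] at hp
    refine ⟨p, hpS, hpM, (norm_fst_le _).trans_lt hp, fun f hf => ?_⟩
    exact ((norm_le_pi_norm (T p - z).2 ⟨f, hf⟩).trans (norm_snd_le _)).trans_lt hp
  by_contra hz
  have hconv : Convex ℝ K := by
    refine Convex.linear_image ?_ T
    refine S.convex.inter (t := {p | ‖p.1‖ ≤ M}) ?_
    have := (convex_closedBall (0 : X) M).linear_preimage (LinearMap.fst ℝ X (StrongDual ℝ X))
    convert this using 1
    ext p
    simp
  obtain ⟨φ, r, hφz, hφK⟩ := geometric_hahn_banach_point_closed hconv.closure isClosed_closure hz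
  set z'' : StrongDual ℝ (StrongDual ℝ X) := φ.comp (ContinuousLinearMap.inl ℝ _ _)
  let k : F → ℝ := fun f => φ (0, fun j => if f = j then 1 else 0)
  set z' : StrongDual ℝ X := ∑ f : F, k f • f.1
  have hφ : ∀ y c, φ (y, c) = z'' y + ∑ f : F, k f * c f := fun y c => by
    have h1 : φ (y, c) = φ (y, 0) + φ (0, c) := by simp [← map_add]
    have h2 := LinearMap.pi_apply_eq_sum_univ
      (φ.toLinearMap ∘ₗ LinearMap.inr ℝ (StrongDual ℝ X) (F → ℝ)) c
    have h3 : φ (0, c) = ∑ f : F, c f * k f := h2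
    rw [h1, h3]
    simp [z'', mul_comm]
  have hφT : ∀ p, φ (T p) = z'' p.2 + z' p.1 := fun p => by
    rw [show T p = (p.2, fun f : F => f.1 p.1) from rfl, hφ]
    simp [z']
  have hφz' : φ z = z'' x' + x'' z' := by
    rw [show z = (x', fun f : F => x'' f) from rfl, hφ, map_sum]
    simp only [map_smul, smul_eq_mul]
  have hr : ∀ p ∈ S, ‖p.1‖ ≤ M → r < z'' p.2 + z' p.1 := fun p hp hpM => by
    rw [← hφT]
    exact hφK _ (subset_closure ⟨p, ⟨hp, hpM⟩, rfl⟩)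
  have hr0 : r < 0 := by simpa using hr 0 S.zero_mem (by simpa using hM0.le)
  obtain ⟨y', hy'N, hy'⟩ := exists_extension_of_le_norm_fst S
    ((z'.coprod z'').toLinearMap) (N := -r / M) (by apply div_nonneg <;> linarith) (by
      intro p hp
      -- If `p.1 ≠ 0` then `t = M / ‖p.1‖` is used, and arbitrarily large `t` otherwise.
      have hl : ∀ t : ℝ, 0 ≤ t → t * ‖p.1‖ ≤ M → t * (z' p.1 + z'' p.2) < -r :=
        fun t ht htM => by
          have := hr (-t • p) (S.smul_mem _ hp) (by simpa [norm_smul, abs_of_nonneg ht] using htM)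
          simp only [Prod.smul_fst, Prod.smul_snd, map_smul, smul_eq_mul] at this
          linarith
      change z' p.1 + z'' p.2 ≤ _
      by_contra! hlt
      rcases eq_or_ne p.1 0 with h0 | h0
      · rw [h0, norm_zero, mul_zero, ← h0] at hlt
        have := hl (-r / (z' p.1 + z'' p.2)) (div_nonneg (by linarith) hlt.le) (by
          simpa [h0] using hM0.le)
        rw [div_mul_cancel₀ _ hlt.ne'] at this
        exact lt_irrefl _ this
      · have hp0 : 0 < ‖p.1‖ := norm_pos_iff.2 h0
        have := hl (M / ‖p.1‖) (by positivity) (by field_simp; rfl)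
        have h2 := mul_lt_mul_of_pos_left hlt (show 0 < M / ‖p.1‖ by positivity)
        have h3 : M / ‖p.1‖ * (-r / M * ‖p.1‖) = -r := by field_simp
        linarith)
  have hadj : ((-z'', z' - y') : StrongDual ℝ (StrongDual ℝ X) × StrongDual ℝ X) ∈
      adjoint (S : SetRel X (StrongDual ℝ X)) := mem_adjoint_iff.2 fun p hp => by
    have h1 : z' p.1 + z'' p.2 = y' p.1 := hy' p hp
    simp only [sub_apply, neg_apply]
    linarith
  have h1 := hx _ hadj
  simp only [map_sub, neg_apply] at h1
  have h2 : -(‖x''‖ * (-r / M)) ≤ x'' y' := by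
    have h3 := neg_abs_le (x'' y')
    have h4 : |x'' y'| ≤ ‖x''‖ * (-r / M) := (x''.le_opNorm y').trans (by gcongr)
    linarith
  have h3 : ‖x''‖ * (-r / M) ≤ -r := by
    rw [← mul_div_assoc, div_le_iff₀ hM0]
    nlinarith
  linarith

theorem IsMonotoneBidual.isTypeD {X : Type u} [NormedAddCommGroup X] [NormedSpace ℝ X]
    {S : Submodule ℝ (X × StrongDual ℝ X)}
    (hS' : IsMonotoneBidual (adjoint (S : SetRel X (StrongDual ℝ X)))) :
    IsTypeD (S : SetRel X (StrongDual ℝ X)) := by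
  intro x'' x' hx
  have hx' : ∀ p ∈ S, 0 ≤ (NormedSpace.inclusionInDoubleDual ℝ X p.1 - x'') (p.2 - x') :=
    fun p hp => EReal.coe_nonneg.1 ((le_iInf₂_iff.1 hx) p hp)
  have hnear := fun γ : Finset (StrongDual ℝ X) × ℕ => exists_mem_near
    (fun w hw => apply_eq_apply_of_mem_adjoint hS' hx' hw) γ.1 (Nat.one_div_pos_of_nat (n := γ.2))
  choose a haS haM ha' haF using hnear
  have hlim : Tendsto (fun γ : Finset (StrongDual ℝ X) × ℕ => 1 / ((γ.2 : ℝ) + 1)) atTop (𝓝 0) :=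
    tendsto_one_div_add_atTop_nhds_zero_nat.comp (by
      rw [← prod_atTop_atTop_eq]
      exact tendsto_snd)
  refine ⟨Finset (StrongDual ℝ X) × ℕ, inferInstance, ?_, inferInstance, a, haS,
    ?_, ?_, ?_⟩
  · classical
    infer_instance
  · refine isBounded_iff_forall_norm_le.2 ⟨max (‖x''‖ + 1) (‖x'‖ + 1), ?_⟩
    rintro _ ⟨γ, rfl⟩
    refine norm_prod_le_iff.2 ⟨(haM γ).trans (le_max_left _ _), le_trans ?_ (le_max_right _ _)⟩
    have h1 : ‖(a γ).2 - x'‖ ≤ 1 := (ha' γ).le.trans (by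
      rw [div_le_one (by positivity)]
      linarith [Nat.cast_nonneg (α := ℝ) γ.2])
    linarith [norm_le_norm_add_norm_sub' (a γ).2 x']
  · refine tendsto_iff_forall_eval_tendsto_topDualPairing.2 fun f => ?_
    refine tendsto_iff_norm_sub_tendsto_zero.2 (squeeze_zero' (Eventually.of_forall fun _ =>
      norm_nonneg _) ?_ hlim)
    filter_upwards [eventually_ge_atTop (({f}, 0) : Finset (StrongDual ℝ X) × ℕ)] with γ hγ
    exact (haF γ f (hγ.1 (Finset.mem_singleton_self f))).le
  · exact tendsto_iff_norm_sub_tendsto_zero.2 (squeeze_zero (fun _ => norm_nonneg _)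
      (fun γ => (ha' γ).le) hlim)

/-! ### Type (NI) implies type (FP) -/

/-- The projection to `X* × ℝ` of the epigraph of the function `⟨a, a*⟩ - L (a, a*)` on `S`, which is
convex because the monotone relation `S` is linear. -/
theorem convex_image_pairing_epigraph {S : Submodule ℝ (X × StrongDual ℝ X)}
    (hS : IsMonotone (S : SetRel X (StrongDual ℝ X))) (L : X × StrongDual ℝ X →ₗ[ℝ] ℝ) :
    Convex ℝ {z : StrongDual ℝ X × ℝ | ∃ p ∈ S, p.2 = z.1 ∧ p.2 p.1 - L p ≤ z.2} := by
  rintro ⟨_, r⟩ ⟨p, hp, rfl, hpr⟩ ⟨_, t⟩ ⟨q, hq, rfl, hqt⟩ α β hα hβ hαβ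
  refine ⟨α • p + β • q, S.add_mem (S.smul_mem _ hp) (S.smul_mem _ hq), rfl, ?_⟩
  have h := mul_nonneg (mul_nonneg hα hβ) (hS p hp q hq)
  obtain rfl : β = 1 - α := by linarith
  simp only [map_sub, sub_apply] at h
  simp only [Prod.fst_add, Prod.snd_add, Prod.smul_fst, Prod.smul_snd, add_apply, smul_apply,
    map_add, map_smul, smul_eq_mul] at hpr hqt ⊢
  nlinarith [mul_le_mul_of_nonneg_left hpr hα, mul_le_mul_of_nonneg_left hqt hβ]

theorem IsTypeNI.isTypeFP {S : Submodule ℝ (X × StrongDual ℝ X)}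
    (hS : IsMaximallyMonotone (S : SetRel X (StrongDual ℝ X)))
    (hNI : IsTypeNI (S : SetRel X (StrongDual ℝ X))) :
    IsTypeFP (S : SetRel X (StrongDual ℝ X)) := by
  intro U hUo hUc hU x x' hx'U hx
  set ι := NormedSpace.inclusionInDoubleDual ℝ X
  let L : X × StrongDual ℝ X →ₗ[ℝ] ℝ := (x'.coprod (ι x)).toLinearMap
  have hL : ∀ p, L p = x' p.1 + p.2 x := fun p => by simp [L, ι]
  suffices hrel : ∀ p ∈ S, 0 ≤ (x' - p.2) (x - p.1) by
    refine hS.2 (y := insert (x, x') (S : Set (X × StrongDual ℝ X))) ?_ (Set.subset_insert _ _)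
      (Set.mem_insert _ _)
    rintro p (rfl | hp) q (rfl | hq)
    · simp
    · exact hrel q hq
    · have h := hrel p hp
      rwa [← neg_sub p.2, ← neg_sub p.1, neg_apply, map_neg, neg_neg] at h
    · exact hS.1 p hp q hq
  have hdisj : Disjoint (U ×ˢ Set.Iio (-x' x)) {z : StrongDual ℝ X × ℝ |
      ∃ p ∈ S, p.2 = z.1 ∧ p.2 p.1 - L p ≤ z.2} := by
    refine Set.disjoint_left.2 ?_
    rintro ⟨_, r⟩ ⟨hpU, hr⟩ ⟨p, hp, rfl, hpr⟩
    have := hx p ⟨hp, trivial, hpU⟩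
    simp only [hL, map_sub, sub_apply, Set.mem_Iio] at this hpr hr
    linarith
  obtain ⟨φ, s, hφU, hφS⟩ := geometric_hahn_banach_open (hUc.prod (convex_Iio _))
    (hUo.prod isOpen_Iio) (convex_image_pairing_epigraph hS.1 L) hdisj
  have hφ : ∀ y r, φ (y, r) = φ (y, 0) + r * φ (0, 1) := fun y r => by
    rw [← smul_eq_mul, ← map_smul, ← map_add, Prod.smul_mk, Prod.mk_add_mk, smul_zero, smul_eq_mul,
      mul_one, add_zero, zero_add]
  obtain ⟨u', hu'U, u, hu⟩ := hU
  -- The separating hyperplane is not vertical, because `U` meets the range of `A`.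
  have hρ : 0 < φ (0, 1) := by
    have h1 := hφU (u', min (-x' x) (u' u - L (u, u')) - 1)
      ⟨hu'U, by simp only [Set.mem_Iio]; linarith [min_le_left (-x' x) (u' u - L (u, u'))]⟩
    have h2 := hφS (u', u' u - L (u, u')) ⟨(u, u'), hu, rfl, le_rfl⟩
    rw [hφ] at h1 h2
    have h3 := min_le_right (-x' x) (u' u - L (u, u'))
    by_contra! hρ
    nlinarith
  set ρ := φ (0, 1)
  set y'' : StrongDual ℝ (StrongDual ℝ X) := φ.comp (ContinuousLinearMap.inl ℝ _ _)
  have hy'' : ∀ y, φ (y, 0) = y'' y := fun y => rfl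
  have hU' : ∀ y ∈ U, y'' y ≤ s + x' x * ρ := fun y hy => by
    have hlim : Tendsto (fun r : ℝ => y'' y + r * ρ) (𝓝[<] (-x' x)) (𝓝 (y'' y + -x' x * ρ)) :=
      Tendsto.mono_left (Continuous.tendsto (by fun_prop) _) nhdsWithin_le_nhds
    have := le_of_tendsto hlim (b := s) (by
      filter_upwards [self_mem_nhdsWithin] with r hr
      have := hφU (y, r) ⟨hy, hr⟩
      rw [hφ, hy''] at this
      exact this.le)
    linarith
  have hS' : ∀ p ∈ S, s ≤ y'' p.2 + (p.2 p.1 - L p) * ρ := fun p hp => by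
    have := hφS (p.2, p.2 p.1 - L p) ⟨p, hp, rfl, le_rfl⟩
    rwa [hφ, hy''] at this
  have hNI' := le_of_isTypeNI hNI (x'' := ι x - ρ⁻¹ • y'') (x' := x') (M := -(ρ⁻¹ * s))
    fun p hp => by
      have h1 := mul_le_mul_of_nonneg_left (hS' p hp) (inv_nonneg.2 hρ.le)
      have h2 : ρ⁻¹ * (y'' p.2 + (p.2 p.1 - L p) * ρ) = ρ⁻¹ * y'' p.2 + (p.2 p.1 - L p) := by
        field_simp
      rw [h2, hL] at h1
      have h3 : ι x p.2 = p.2 x := NormedSpace.dual_def ..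
      simp only [sub_apply, smul_apply, smul_eq_mul, h3]
      linarith
  have hs : s + x' x * ρ ≤ y'' x' := by
    have h3 : ι x x' = x' x := NormedSpace.dual_def ..
    simp only [sub_apply, smul_apply, smul_eq_mul, h3] at hNI'
    have h4 := mul_le_mul_of_nonneg_left hNI' hρ.le
    have h5 : ρ * (x' x - ρ⁻¹ * y'' x') = x' x * ρ - y'' x' := by field_simp
    have h6 : ρ * -(ρ⁻¹ * s) = -s := by field_simp
    linarith
  have hy0 : y'' = 0 := by
    have hmax : IsLocalMax y'' x' := by
      filter_upwards [hUo.mem_nhds hx'U] with y hy using (hU' y hy).trans hs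
    exact hmax.hasFDerivAt_eq_zero y''.hasFDerivAt
  intro p hp
  have h1 := hS' p hp
  have h2 := hU' x' hx'U
  simp only [hy0, zero_apply, hL] at h1 h2
  simp only [map_sub, sub_apply]
  have h3 : 0 ≤ (p.2 p.1 - (x' p.1 + p.2 x) + x' x) * ρ := by linarith
  linarith [nonneg_of_mul_nonneg_left h3 hρ]

/-! ### Type (FP) implies monotonicity of the adjoint -/

theorem IsTypeFP.isMonotoneBidual_adjoint {S : Submodule ℝ (X × StrongDual ℝ X)}
    (hS : IsMonotone (S : SetRel X (StrongDual ℝ X)))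
    (hFP : IsTypeFP (S : SetRel X (StrongDual ℝ X))) :
    IsMonotoneBidual (adjoint (S : SetRel X (StrongDual ℝ X))) := by
  refine isMonotoneBidual_adjoint_iff.2 ?_
  rintro ⟨x'', x'⟩ hq
  by_contra! hneg
  change x'' x' < 0 at hneg
  have hadj : ∀ p ∈ S, x' p.1 = x'' p.2 := mem_adjoint_iff.1 hq
  obtain ⟨x, hx⟩ : ∃ x : X, x' x = x'' x' := by
    have hx' : x' ≠ 0 := by
      rintro rfl
      simp at hneg
    obtain ⟨y, hy⟩ := DFunLike.ne_iff.1 hx'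
    exact ⟨(x'' x' / x' y) • y, by rw [map_smul, smul_eq_mul, div_mul_cancel₀ _ hy]⟩
  set ι := NormedSpace.inclusionInDoubleDual ℝ X
  obtain ⟨ε, hε, hεx⟩ : ∃ ε > 0, ‖x'' - ι x‖ * ε < -x'' x' := by
    refine ⟨-x'' x' / (‖x'' - ι x‖ + 1), div_pos (by linarith) (by positivity), ?_⟩
    rw [← mul_div_assoc, div_lt_iff₀ (by positivity)]
    nlinarith
  let U := Metric.thickening ε (segment ℝ 0 (-x'))
  have hsub : segment ℝ 0 (-x') ⊆ U := Metric.self_subset_thickening hε _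
  have hpos : ∀ p ∈ S, p.2 ∈ U → 0 < (-x' - p.2) (x - p.1) := fun p hp hpU => by
    obtain ⟨y, hy, hpy⟩ := Metric.mem_thickening_iff.1 hpU
    obtain ⟨t, -, rfl⟩ := (segment_eq_image' ℝ (0 : StrongDual ℝ X) (-x')).subset hy
    have h1 := hS.nonneg hp
    have h2 := hadj p hp
    have h3 : (x'' - ι x) x' = 0 := by
      have : ι x x' = x' x := NormedSpace.dual_def ..
      simp [this, hx]
    -- `x'' - ι x` vanishes on the line through `x'`, hence is small on `U`.
    have h4 : (x'' - ι x) p.2 = (x'' - ι x) (p.2 - (0 + t • (-x' - 0))) := by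
      rw [zero_add, sub_zero, map_sub, map_smul, map_neg, h3, neg_zero, smul_zero, sub_zero]
    have h5 : |(x'' - ι x) p.2| ≤ ‖x'' - ι x‖ * ε := by
      rw [h4]
      refine ((x'' - ι x).le_opNorm _).trans ?_
      rw [dist_eq_norm] at hpy
      gcongr
    have h6 := neg_abs_le ((x'' - ι x) p.2)
    have h7 : ι x p.2 = p.2 x := NormedSpace.dual_def ..
    simp only [sub_apply, h7] at h5 h6
    simp only [map_sub, sub_apply, neg_apply]
    linarith
  have hmem : (x, -x') ∈ (S : Set (X × StrongDual ℝ X)) :=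
    hFP U Metric.isOpen_thickening ((convex_segment _ _).thickening _)
      ⟨0, hsub (left_mem_segment _ _ _), 0, S.zero_mem⟩ x (-x') (hsub (right_mem_segment _ _ _))
      fun p hp => (hpos p hp.1 hp.2.2).le
  simpa using hpos _ hmem (hsub (right_mem_segment _ _ _))

end MonotoneOperator

theorem theorem3p1 {X : Type*} [NormedAddCommGroup X] [NormedSpace ℝ X] [CompleteSpace X]
    (A : SetRel X (StrongDual ℝ X)) (hmax : MonotoneOperator.IsMaximallyMonotone A)
    (hlin : MonotoneOperator.IsLinearRelation A) :
    List.TFAE [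
      MonotoneOperator.IsTypeD A,
      MonotoneOperator.IsTypeNI A,
      MonotoneOperator.IsMonotoneBidual (MonotoneOperator.adjoint A),
      MonotoneOperator.IsTypeFP A] := by
  obtain ⟨S, rfl⟩ := hlin
  tfae_have 1 → 2 := fun h => h.isTypeNI
  tfae_have 2 → 3 := fun h => h.isMonotoneBidual_adjoint hmax.1
  tfae_have 3 → 1 := fun h => h.isTypeD
  tfae_have 2 → 4 := fun h => h.isTypeFP hmax
  tfae_have 4 → 3 := fun h => h.isMonotoneBidual_adjoint hmax.1
  tfae_finish
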